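/- Let $0<\lambda_1<1<\lambda_2$ be real numbers with $\lambda_1\lambda_2<\tfrac14$, and let $d_1,d_2\in\mathbb{R}$ be such that the maps $x\mapsto\lambda_1x+d_1$ and $x\mapsto\lambda_2x+d_2$ have no common fixed point. For $\lambda>0$ with $\lambda\lambda_2<1$ let $\mu_{\lambda,\lambda_2}$ denote the stationary measure of the iterated function system $f_1(x)=\lambda x+d_1$, $f_2(x)=\lambda_2x+d_2$ with probabilities $(\tfrac12,\tfrac12)$, that is, the unique Borel probability measure $\mu$ on $\mathbb{R}$ with $\mu=\tfrac12 (f_1)_*\mu+\tfrac12 (f_2)_*\mu$. Then there exists a bounded $C^\infty$ function $\varphi:\mathbb{R}\to\mathbb{R}$ such that the function $$h(\varepsilon)=\int_{\mathbb{R}}\varphi\,d\mu_{\lambda_1+\varepsilon,\lambda_2},$$ defined for all $\varepsilon$ close enough to $0$, is not differentiable at $\varepsilon=0$. -/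

import Mathlib

open MeasureTheory
open scoped ENNReal ContDiff

/-- `μ` is a stationary measure of the probabilistic iterated function system
`f₁ x = l₁ * x + d₁`, `f₂ x = l₂ * x + d₂` with probability vector `(1/2, 1/2)`: it is a Borel
probability measure on the line with `μ = (1/2) (f₁)_* μ + (1/2) (f₂)_* μ`. -/
def IsStationaryMeasure (l₁ l₂ d₁ d₂ : ℝ) (μ : Measure ℝ) : Prop :=
  IsProbabilityMeasure μ ∧
    μ = (2⁻¹ : ℝ≥0∞) • μ.map (fun x : ℝ => l₁ * x + d₁) +
        (2⁻¹ : ℝ≥0∞) • μ.map (fun x : ℝ => l₂ * x + d₂)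

open Classical in
/-- The stationary measure of the system, that is, its unique stationary measure
(and the zero measure by convention when there is no unique one, which does not occur for
`0 < l₁`, `0 < l₂`, `l₁ * l₂ < 1`). -/
noncomputable def stationaryMeasure (l₁ l₂ d₁ d₂ : ℝ) : Measure ℝ :=
  if h : ∃! μ : Measure ℝ, IsStationaryMeasure l₁ l₂ d₁ d₂ μ then h.choose else 0

/-
Read `μ_l = stationaryMeasure l l₂ d₁ d₂` as the law of a random series in independent coin
tosses. By the law of large numbers the composition of the first `n` maps has ratio about
`(l l₂)^(n/2)`, while there are only `2^n` such compositions. As `l₁ l₂ < 1/4`, almost every point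
of `μ_{l₁}` lies for all large `n` in a set of summable Lebesgue measure, so `μ_{l₁}` is singular.
It has no atoms, since the atoms of maximal mass form a finite set mapped into itself by the
inverse maps, whose barycentre would be a common fixed point.

For almost every sequence of tosses the random series is a nonconstant analytic function of the
ratio `l`, so Lebesgue null sets have null preimages under it. By Fubini, a null set carrying
`μ_{l₁}` is therefore `μ_l`-null for almost every `l`: these `μ_l` are mutually singular with
`μ_{l₁}`.

Finally `μ_{l₁}` has unbounded support because `l₂ > 1`, so it charges infinitely many disjoint
open sets `V n` forming a locally finite family. Choosing parameters `y n` very close to `l₁` with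
`μ_{y n}` singular to `μ_{l₁}`, some smooth bump `f n` in `V n` has a difference quotient
`(∫ f n dμ_{y n} - ∫ f n dμ_{l₁}) / (y n - l₁)` of modulus at least `n`. If all smooth bounded
functions had differentiable integrals, Banach–Steinhaus on `ℓ^∞`, applied to `a ↦ ∑ a n • f n`,
would bound these quotients uniformly.
-/

open Filter Finset Topology ProbabilityTheory

section Sequences

variable {α : Type*}

/-- The one-sided shift on sequences. -/
def tail (w : ℕ → α) : ℕ → α := fun n => w (n + 1)

variable [MeasurableSpace α]

@[fun_prop]
lemma measurable_tail : Measurable (tail : (ℕ → α) → ℕ → α) :=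
  measurable_pi_lambda _ fun n => measurable_pi_apply (n + 1)

/-- The law of a sequence of independent letters with common law `ν`. -/
noncomputable abbrev seqLaw (ν : Measure α) : Measure (ℕ → α) := Measure.infinitePi fun _ => ν

variable (ν : Measure α) [IsProbabilityMeasure ν]

lemma measurePreserving_tail : MeasurePreserving tail (seqLaw ν) (seqLaw ν) :=
  ⟨measurable_tail, Measure.map_infinitePi_infinitePi_of_inj (add_left_injective 1)⟩

lemma indepFun_head_tail : IndepFun (fun w => w 0) tail (seqLaw ν) := by
  have h : iIndepFun (fun n (w : ℕ → α) => w n) (seqLaw ν) :=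
    iIndepFun_infinitePi (X := fun _ => id) fun _ => measurable_id
  have h_disj : Disjoint ({0} : Set ℕ) (Set.Ioi 0) := by simp
  refine indep_of_indep_of_le_left (indep_of_indep_of_le_right (indep_iSup_of_disjoint
    (fun n => (measurable_pi_apply n).comap_le) h.iIndep h_disj) ?_) (by simp)
  simp only [MeasurableSpace.pi, MeasurableSpace.comap_iSup, MeasurableSpace.comap_comp]
  exact iSup_le fun n => le_iSup₂_of_le (n + 1) n.succ_pos le_rfl

lemma measurePreserving_head_tail :
    MeasurePreserving (fun w => (w 0, tail w)) (seqLaw ν) (ν.prod (seqLaw ν)) := by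
  refine ⟨by fun_prop, ?_⟩
  rw [(indepFun_head_tail ν).map_prod_eq_prod_map_map (measurable_pi_apply 0).aemeasurable
      measurable_tail.aemeasurable, (measurePreserving_tail ν).map_eq,
    Measure.infinitePi_map_eval]

variable {ν} in
lemma ae_exists_mem {s : Set α} (hs : MeasurableSet s) (h : ν s ≠ 0) :
    ∀ᵐ w ∂seqLaw ν, ∃ n, w n ∈ s := by
  have h_le (n : ℕ) : seqLaw ν {w | ¬ ∃ i, w i ∈ s} ≤ ν sᶜ ^ n :=
    calc seqLaw ν {w | ¬ ∃ i, w i ∈ s} ≤ seqLaw ν (Set.pi (range n) fun _ => sᶜ) :=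
        measure_mono fun w hw i _ hi => hw ⟨i, hi⟩
      _ = ν sᶜ ^ n := by rw [Measure.infinitePi_pi _ fun _ _ => hs.compl, prod_const, card_range]
  have h_lt : ν sᶜ < 1 := by
    rw [prob_compl_eq_one_sub hs]
    exact ENNReal.sub_lt_self ENNReal.one_ne_top one_ne_zero h
  exact le_antisymm
    (ge_of_tendsto' (ENNReal.tendsto_pow_atTop_nhds_zero_of_lt_one h_lt) h_le) zero_le

end Sequences

section Orbits

variable {α : Type*}

/-- The product of the ratios `r` along the first `n` letters of `w`: the linear part of
the composition of the affine maps `y ↦ r a * y + t a` spelled by these letters. -/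
def weight {R : Type*} [CommMonoid R] (r : α → R) (w : ℕ → α) (n : ℕ) : R := ∏ i ∈ range n, r (w i)

lemma weight_succ {R : Type*} [CommMonoid R] (r : α → R) (w : ℕ → α) (n : ℕ) :
    weight r w (n + 1) = r (w 0) * weight r (tail w) n := by
  simp [weight, tail, prod_range_succ', mul_comm]

lemma norm_weight_le {𝕜 : Type*} [NormedField 𝕜] {r : α → 𝕜} {ρ : α → ℝ} (h : ∀ a, ‖r a‖ ≤ ρ a)
    (w : ℕ → α) (n : ℕ) : ‖weight r w n‖ ≤ weight ρ w n := by
  simpa only [weight, norm_prod] using prod_le_prod (fun _ _ => norm_nonneg _) fun i _ => h (w i)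

lemma weight_pos {r : α → ℝ} (hr : ∀ a, 0 < r a) (w : ℕ → α) (n : ℕ) : 0 < weight r w n :=
  prod_pos fun _ _ => hr _

/-- The image of `y` under the composition of the maps `y ↦ r a * y + t a` along the first `n`
letters of `w`, the map of the first letter being applied last. -/
def orbit {R : Type*} [CommSemiring R] (r t : α → R) (n : ℕ) (w : ℕ → α) (y : R) : R :=
  ∑ i ∈ range n, weight r w i * t (w i) + weight r w n * y

lemma orbit_succ {R : Type*} [CommSemiring R] (r t : α → R) (n : ℕ) (w : ℕ → α) (y : R) :
    orbit r t (n + 1) w y = r (w 0) * orbit r t n (tail w) y + t (w 0) := by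
  have h_zero : weight r w 0 = 1 := prod_range_zero _
  simp only [orbit, sum_range_succ', weight_succ, h_zero, tail, one_mul, mul_add, mul_sum,
    mul_assoc]
  ring

lemma dist_orbit_orbit (r t : α → ℝ) (n : ℕ) (w : ℕ → α) (x y : ℝ) :
    dist (orbit r t n w x) (orbit r t n w y) = |weight r w n| * dist x y := by
  simp [orbit, Real.dist_eq, ← mul_sub, abs_mul]

/-- The limit of `orbit r t n w y` as `n → ∞`, provided that the weights along `w` are summable. -/
noncomputable def limitPoint {𝕜 : Type*} [NormedField 𝕜] (r t : α → 𝕜) (w : ℕ → α) : 𝕜 :=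
  ∑' i, weight r w i * t (w i)

lemma summable_weight_tail {r : α → ℝ} {w : ℕ → α} (h₀ : r (w 0) ≠ 0)
    (h : Summable (weight r w)) : Summable (weight r (tail w)) := by
  rw [← summable_nat_add_iff 1] at h
  simpa only [weight_succ, summable_mul_left_iff h₀] using h

section Finite

variable [Finite α] {𝕜 : Type*} [NormedField 𝕜] {r : α → 𝕜} {w : ℕ → α}

lemma exists_norm_le_of_finite (t : α → 𝕜) : ∃ T, ∀ a, ‖t a‖ ≤ T :=
  let ⟨T, hT⟩ := (Set.finite_range fun a => ‖t a‖).bddAbove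
  ⟨T, fun a => hT (Set.mem_range_self a)⟩

variable [CompleteSpace 𝕜]

lemma summable_weight_mul (h : Summable fun n => ‖weight r w n‖) (t : α → 𝕜) :
    Summable fun n => weight r w n * t (w n) := by
  obtain ⟨T, hT⟩ := exists_norm_le_of_finite t
  refine .of_norm_bounded (h.mul_right T) fun n => ?_
  rw [norm_mul]
  gcongr
  exact hT _

lemma tendsto_orbit (h : Summable fun n => ‖weight r w n‖) (t : α → 𝕜) (y : 𝕜) :
    Tendsto (fun n => orbit r t n w y) atTop (𝓝 (limitPoint r t w)) := by
  simpa [orbit, limitPoint] using (summable_weight_mul h t).hasSum.tendsto_sum_nat.add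
    (h.of_norm.tendsto_atTop_zero.mul_const y)

lemma limitPoint_eq (h : Summable fun n => ‖weight r w n‖) (t : α → 𝕜) :
    limitPoint r t w = r (w 0) * limitPoint r t (tail w) + t (w 0) := by
  rw [limitPoint, (summable_weight_mul h t).tsum_eq_zero_add]
  simp only [weight_succ, mul_assoc, tsum_mul_left]
  simp [limitPoint, weight, tail, add_comm]

end Finite

end Orbits

section LawOfLargeNumbers

variable {α : Type*} [Finite α] [MeasurableSpace α] [MeasurableSingletonClass α] (ν : Measure α)
  [IsProbabilityMeasure ν] {r : α → ℝ}

lemma ae_tendsto_log_weight_div (hr : ∀ a, r a ≠ 0) :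
    ∀ᵐ w ∂seqLaw ν, Tendsto (fun n : ℕ => Real.log (weight r w n) / n) atTop
      (𝓝 (∫ a, Real.log (r a) ∂ν)) := by
  have h_meas : Measurable fun a => Real.log (r a) := measurable_of_finite _
  have h_eval (i : ℕ) : MeasurePreserving (fun w : ℕ → α => w i) (seqLaw ν) ν :=
    measurePreserving_eval_infinitePi (fun _ => ν) i
  have h_indep := iIndepFun_infinitePi (P := fun _ : ℕ => ν) fun _ => h_meas
  have h_ident (i : ℕ) : IdentDistrib (fun w => Real.log (r (w i))) (fun w => Real.log (r (w 0)))
      (seqLaw ν) (seqLaw ν) :=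
    (IdentDistrib.mk (h_eval i).aemeasurable (h_eval 0).aemeasurable
      ((h_eval i).map_eq.trans (h_eval 0).map_eq.symm)).comp h_meas
  have h_int : Integrable (fun w => Real.log (r (w 0))) (seqLaw ν) :=
    (h_eval 0).integrable_comp_of_integrable (g := fun a => Real.log (r a)) .of_finite
  have h_mean : ∫ w, Real.log (r (w 0)) ∂seqLaw ν = ∫ a, Real.log (r a) ∂ν := by
    rw [← integral_map (h_eval 0).aemeasurable h_meas.aestronglyMeasurable, (h_eval 0).map_eq]
  filter_upwards [strong_law_ae_real _ h_int (fun i j hij => h_indep.indepFun hij) h_ident]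
    with w hw
  simpa only [weight, Real.log_prod fun i _ => hr (w i), h_mean] using hw

lemma ae_eventually_weight_le (hr : ∀ a, 0 < r a) {c : ℝ} (hc : ∫ a, Real.log (r a) ∂ν < c) :
    ∀ᵐ w ∂seqLaw ν, ∀ᶠ n in atTop, weight r w n ≤ Real.exp c ^ n := by
  filter_upwards [ae_tendsto_log_weight_div ν fun a => (hr a).ne'] with w hw
  filter_upwards [hw.eventually_lt_const hc, eventually_gt_atTop 0] with n hn hn₀
  rw [div_lt_iff₀ (by positivity), mul_comm, Real.log_lt_iff_lt_exp (weight_pos hr w n),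
    Real.exp_nat_mul] at hn
  exact hn.le

lemma ae_summable_weight (hr : ∀ a, 0 < r a) (h : ∫ a, Real.log (r a) ∂ν < 0) :
    ∀ᵐ w ∂seqLaw ν, Summable (weight r w) := by
  obtain ⟨c, hc, hc₀⟩ := exists_between h
  filter_upwards [ae_eventually_weight_le ν hr hc] with w hw
  refine .of_norm_bounded_eventually_nat
    (summable_geometric_of_lt_one (Real.exp_pos c).le (Real.exp_lt_one_iff.2 hc₀)) ?_
  filter_upwards [hw] with n hn
  rwa [Real.norm_of_nonneg (weight_pos hr w n).le]

end LawOfLargeNumbers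

section Stationary

variable {α : Type*} [MeasurableSpace α]

/-- `μ` is a stationary measure of the random affine map `y ↦ r a * y + t a`, whose index `a` has
law `ν`: a probability measure which is the law of `r a * y + t a` for independent `a` and `y` with
laws `ν` and `μ`. -/
structure IsAffineStationary (ν : Measure α) (r t : α → ℝ) (μ : Measure ℝ) : Prop where
  isProbabilityMeasure : IsProbabilityMeasure μ
  measurePreserving : MeasurePreserving (fun q : α × ℝ => r q.1 * q.2 + t q.1) (ν.prod μ) μ

variable {ν : Measure α} [IsProbabilityMeasure ν] {r t : α → ℝ} {μ : Measure ℝ}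

lemma IsAffineStationary.measurePreserving_orbit (h : IsAffineStationary ν r t μ) (n : ℕ) :
    MeasurePreserving (fun q => orbit r t n q.1 q.2) ((seqLaw ν).prod μ) μ := by
  have := h.isProbabilityMeasure
  induction n with
  | zero => simpa [orbit, weight] using measurePreserving_snd
  | succ n ih =>
    have h_step := h.measurePreserving.comp <| ((MeasurePreserving.id ν).prod ih).comp <|
      (measurePreserving_prodAssoc ν (seqLaw ν) μ).comp <|
      (measurePreserving_head_tail ν).prod (.id μ)
    simp only [orbit_succ]
    exact h_step

variable [Finite α] [MeasurableSingletonClass α]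

lemma measurable_uncurry_limitPoint {X : Type*} [MeasurableSpace X] {R : X → α → ℝ}
    (hR : ∀ a, Measurable fun x => R x a) (t : α → ℝ) :
    Measurable fun q : X × (ℕ → α) => limitPoint (R q.1) t q.2 := by
  have h_letter (j : ℕ) : Measurable fun q : X × (ℕ → α) => q.2 j :=
    (measurable_pi_apply j).comp measurable_snd
  have h_ratio (j : ℕ) : Measurable fun q : X × (ℕ → α) => R q.1 (q.2 j) :=
    (measurable_from_prod_countable_left (f := fun q : X × α => R q.1 q.2) hR).comp
      (measurable_fst.prodMk (h_letter j))
  exact .tsum fun i => (Finset.measurable_fun_prod _ fun j _ => h_ratio j).mul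
    ((measurable_of_finite t).comp (h_letter i))

@[fun_prop]
lemma measurable_limitPoint (r t : α → ℝ) : Measurable (limitPoint r t) :=
  (measurable_uncurry_limitPoint (X := Unit) (R := fun _ => r) (fun _ => measurable_const) t).comp
    (measurable_prodMk_left (x := ()))

lemma isAffineStationary_map_limitPoint (hr : ∀ a, 0 < r a)
    (h_log : ∫ a, Real.log (r a) ∂ν < 0) :
    IsAffineStationary ν r t ((seqLaw ν).map (limitPoint r t)) := by
  have h_meas := measurable_limitPoint r t
  have h_map : Measurable fun q : α × ℝ => r q.1 * q.2 + t q.1 := by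
    have hr := measurable_of_finite r
    have ht := measurable_of_finite t
    fun_prop
  refine ⟨Measure.isProbabilityMeasure_map h_meas.aemeasurable, h_map, ?_⟩
  have h_pair : MeasurePreserving (fun w => (w 0, limitPoint r t (tail w))) (seqLaw ν)
      (ν.prod ((seqLaw ν).map (limitPoint r t))) :=
    ((MeasurePreserving.id ν).prod (h_meas.measurePreserving _)).comp
      (measurePreserving_head_tail ν)
  rw [← h_pair.map_eq, Measure.map_map h_map h_pair.measurable]
  refine Measure.map_congr ?_
  filter_upwards [ae_summable_weight ν hr h_log] with w hw
  exact (limitPoint_eq hw.norm t).symm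

lemma IsAffineStationary.eq_map_limitPoint (h : IsAffineStationary ν r t μ) (hr : ∀ a, 0 < r a)
    (h_log : ∫ a, Real.log (r a) ∂ν < 0) : μ = (seqLaw ν).map (limitPoint r t) := by
  have := h.isProbabilityMeasure
  have h_meas := measurable_limitPoint r t
  have := Measure.isProbabilityMeasure_map (μ := seqLaw ν) h_meas.aemeasurable
  refine ext_of_forall_integral_eq_of_IsFiniteMeasure fun f => ?_
  have h_orbit (n : ℕ) : ∫ x, f x ∂μ = ∫ q, f (orbit r t n q.1 q.2) ∂(seqLaw ν).prod μ := by
    conv_lhs => rw [← (h.measurePreserving_orbit n).map_eq]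
    exact integral_map (h.measurePreserving_orbit n).aemeasurable
      f.continuous.aestronglyMeasurable
  have h_lim : ∫ q, f (limitPoint r t q.1) ∂(seqLaw ν).prod μ
      = ∫ x, f x ∂(seqLaw ν).map (limitPoint r t) := by
    rw [integral_fun_fst (fun w => f (limitPoint r t w)),
      integral_map h_meas.aemeasurable f.continuous.aestronglyMeasurable]
    simp
  rw [← h_lim]
  refine tendsto_nhds_unique (tendsto_const_nhds.congr h_orbit) <|
    tendsto_integral_of_dominated_convergence (fun _ => ‖f‖)
      (fun n => (f.continuous.measurable.comp
        (h.measurePreserving_orbit n).measurable).aestronglyMeasurable)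
      (integrable_const _) (fun n => .of_forall fun q => f.norm_coe_le_norm _) ?_
  filter_upwards [Measure.quasiMeasurePreserving_fst.ae (ae_summable_weight ν hr h_log)]
    with q hq
  exact (f.continuous.tendsto _).comp (tendsto_orbit hq.norm t q.2)

end Stationary

section Singularity

lemma mutuallySingular_of_tendsto_compl_of_tsum_ne_top {X : Type*} [MeasurableSpace X]
    {μ ν : Measure X} {A : ℕ → Set X} (hμ : Tendsto (fun n => μ (A n)ᶜ) atTop (𝓝 0))
    (hν : ∑' n, ν (A n) ≠ ⊤) : μ ⟂ₘ ν := by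
  have h_inter (N : ℕ) : μ (⋂ n ≥ N, (A n)ᶜ) = 0 :=
    le_antisymm (ge_of_tendsto hμ <| eventually_atTop.2
      ⟨N, fun n hn => measure_mono (Set.biInter_subset_of_mem hn)⟩) zero_le
  refine .mk (measure_iUnion_null h_inter) (measure_limsup_atTop_eq_zero hν) fun x _ => ?_
  rw [Set.mem_union, mem_limsup_iff_frequently_mem, frequently_atTop, or_iff_not_imp_right]
  simp

variable {α : Type*} [Finite α]

lemma exists_finset_orbit_mem {R : Type*} [CommSemiring R] (r t : α → R) (n : ℕ) (y : R) :
    ∃ S : Finset R, #S ≤ Nat.card α ^ n ∧ ∀ w, orbit r t n w y ∈ S := by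
  classical
  have := Fintype.ofFinite α
  induction n with
  | zero => exact ⟨{y}, by simp, fun w => by simp [orbit, weight]⟩
  | succ n ih =>
    obtain ⟨S, h_card, h_mem⟩ := ih
    refine ⟨image (fun q : α × R => r q.1 * q.2 + t q.1) (univ ×ˢ S), ?_, fun w => ?_⟩
    · calc #(image _ (univ ×ˢ S)) ≤ Nat.card α * #S := by
            simpa using card_image_le (s := univ ×ˢ S)
        _ ≤ Nat.card α ^ (n + 1) := by rw [pow_succ']; gcongr
    · rw [orbit_succ]
      exact mem_image_of_mem _ (mk_mem_product (mem_univ (w 0)) (h_mem (tail w)))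

variable [MeasurableSpace α] [MeasurableSingletonClass α] {ν : Measure α} [IsProbabilityMeasure ν]
  {r t : α → ℝ} {μ : Measure ℝ}

lemma IsAffineStationary.tendsto_measure_iUnion_closedBall_compl (h : IsAffineStationary ν r t μ)
    (hr : ∀ a, 0 < r a) {c : ℝ} (hc : ∫ a, Real.log (r a) ∂ν < c) {S : ℕ → Finset ℝ}
    (hS : ∀ n w, orbit r t n w 0 ∈ S n) :
    Tendsto (fun n => μ (⋃ x ∈ S n, Metric.closedBall x (n * Real.exp c ^ n))ᶜ) atTop (𝓝 0) := by
  have := h.isProbabilityMeasure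
  let A := fun n => ⋃ x ∈ S n, Metric.closedBall x (n * Real.exp c ^ n)
  have hA (n : ℕ) : MeasurableSet (A n)ᶜ :=
    ((S n).measurableSet_biUnion fun _ _ => measurableSet_closedBall).compl
  have h_eq (n : ℕ) := (h.measurePreserving_orbit n).measure_preimage (hA n).nullMeasurableSet
  change Tendsto (fun n => μ (A n)ᶜ) atTop (𝓝 0)
  simp only [← h_eq]
  rw [← measure_empty (μ := (seqLaw ν).prod μ)]
  refine tendsto_measure_of_ae_tendsto_indicator_of_isFiniteMeasure _ .empty
    (fun n => (h.measurePreserving_orbit n).measurable (hA n)) ?_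
  filter_upwards [Measure.quasiMeasurePreserving_fst.ae (ae_eventually_weight_le ν hr hc)]
    with ⟨w, y⟩ hw
  filter_upwards [hw, eventually_ge_atTop ⌈|y|⌉₊] with n hn hy
  have h_mem : orbit r t n w y ∈ A n := by
    refine Set.mem_iUnion₂.2 ⟨_, hS n w, ?_⟩
    rw [Metric.mem_closedBall, dist_orbit_orbit, abs_of_pos (weight_pos hr w n), mul_comm,
      Real.dist_0_eq_abs]
    exact mul_le_mul (Nat.ceil_le.1 hy) hn (weight_pos hr w n).le (Nat.cast_nonneg n)
  simpa using h_mem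

lemma tsum_volume_iUnion_closedBall_ne_top {k : ℕ} {θ : ℝ} (hθ : 0 ≤ θ) (hkθ : k * θ < 1)
    {S : ℕ → Finset ℝ} (hS : ∀ n, #(S n) ≤ k ^ n) :
    ∑' n, volume (⋃ x ∈ S n, Metric.closedBall x (n * θ ^ n)) ≠ ⊤ := by
  have h_le (n : ℕ) : volume (⋃ x ∈ S n, Metric.closedBall x (n * θ ^ n))
      ≤ ENNReal.ofReal (2 * (n * (k * θ) ^ n)) :=
    calc volume (⋃ x ∈ S n, Metric.closedBall x (n * θ ^ n))
        ≤ ∑ x ∈ S n, volume (Metric.closedBall x (n * θ ^ n)) := measure_biUnion_finset_le _ _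
      _ = ENNReal.ofReal (#(S n) * (2 * (n * θ ^ n))) := by
        simp [Real.volume_closedBall, ENNReal.ofReal_mul]
      _ ≤ ENNReal.ofReal (k ^ n * (2 * (n * θ ^ n))) := by
        gcongr; exact_mod_cast hS n
      _ = ENNReal.ofReal (2 * (n * (k * θ) ^ n)) := by ring_nf
  have h_summable : Summable fun n : ℕ => 2 * ((n : ℝ) * (k * θ) ^ n) := by
    refine .mul_left 2 ?_
    simpa using summable_pow_mul_geometric_of_norm_lt_one 1
      (show ‖k * θ‖ < 1 by rwa [Real.norm_of_nonneg (by positivity)])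
  exact ne_top_of_le_ne_top h_summable.tsum_ofReal_ne_top (ENNReal.tsum_le_tsum h_le)

lemma IsAffineStationary.mutuallySingular_volume (h : IsAffineStationary ν r t μ)
    (hr : ∀ a, 0 < r a) (h_log : ∫ a, Real.log (r a) ∂ν < -Real.log (Nat.card α)) :
    μ ⟂ₘ volume := by
  have : Nonempty α := ν.nonempty_of_neZero
  obtain ⟨c, hc, hc'⟩ := exists_between h_log
  choose S hS_card hS_mem using fun n => exists_finset_orbit_mem r t n 0
  have h_card : Nat.card α * Real.exp c < 1 := by
    rw [← Real.exp_log (Nat.cast_pos.2 Nat.card_pos : (0 : ℝ) < Nat.card α), ← Real.exp_add,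
      Real.exp_lt_one_iff]
    linarith
  exact mutuallySingular_of_tendsto_compl_of_tsum_ne_top
    (h.tendsto_measure_iUnion_closedBall_compl hr hc hS_mem)
    (tsum_volume_iUnion_closedBall_ne_top (Real.exp_pos c).le h_card hS_card)

end Singularity

section Atoms

lemma finite_setOf_le_measure_singleton {X : Type*} [MeasurableSpace X]
    [MeasurableSingletonClass X] (μ : Measure X) [IsFiniteMeasure μ] {ε : ℝ≥0∞} (hε : ε ≠ 0) :
    {x | ε ≤ μ {x}}.Finite :=
  Measure.finite_const_le_meas_of_disjoint_iUnion μ (pos_iff_ne_zero.2 hε) measurableSet_singleton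
    (fun _ _ h => Set.disjoint_singleton.2 h) (measure_ne_top μ _)

lemma exists_forall_measure_singleton_le {X : Type*} [MeasurableSpace X]
    [MeasurableSingletonClass X] {μ : Measure X} [IsFiniteMeasure μ]
    (h : ¬ NullSingletonClass μ) : ∃ x, μ {x} ≠ 0 ∧ ∀ y, μ {y} ≤ μ {x} := by
  obtain ⟨x₀, hx₀⟩ : ∃ x, μ {x} ≠ 0 := by
    by_contra! h₀
    exact h ⟨h₀⟩
  obtain ⟨x, hx, h_max⟩ := Set.exists_max_image _ (fun x => μ {x})
    (finite_setOf_le_measure_singleton μ hx₀) ⟨x₀, le_refl (μ {x₀})⟩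
  refine ⟨x, (hx₀.bot_lt.trans_le hx).ne', fun y => ?_⟩
  rcases le_total (μ {x₀}) (μ {y}) with hy | hy
  · exact h_max y hy
  · exact hy.trans hx

lemma mul_centroid_add_eq {K : Type*} [Field K] [CharZero K] {F : Finset K} (hF : F.Nonempty)
    {r t : K} (hr : r ≠ 0) (h : ∀ x ∈ F, (x - t) / r ∈ F) :
    r * ((∑ x ∈ F, x) / #F) + t = (∑ x ∈ F, x) / #F := by
  classical
  have h_inj : Function.Injective fun x => (x - t) / r := fun x y hxy => by
    simpa [div_left_inj' hr] using hxy
  have h_image : F.image (fun x => (x - t) / r) = F :=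
    eq_of_subset_of_card_le (image_subset_iff.2 h) (card_image_of_injective F h_inj).ge
  have h_sum : ∑ x ∈ F, x = (∑ x ∈ F, x - #F * t) / r := by
    conv_lhs => rw [← h_image, sum_image h_inj.injOn, ← sum_div, sum_sub_distrib, sum_const,
      nsmul_eq_mul]
  have h_card : (#F : K) ≠ 0 := Nat.cast_ne_zero.2 (card_ne_zero.2 hF)
  field_simp at h_sum ⊢
  linear_combination h_sum

variable {α : Type*} [MeasurableSpace α] {ν : Measure α} {r t : α → ℝ} {μ : Measure ℝ}

lemma IsAffineStationary.ae_affine (h : IsAffineStationary ν r t μ) {p : ℝ → Prop}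
    (hp : ∀ᵐ x ∂μ, p x) {a : α} (ha : ν {a} ≠ 0) : ∀ᵐ x ∂μ, p (r a * x + t a) := by
  have := h.isProbabilityMeasure
  have h_ae := Measure.ae_ae_of_ae_prod (h.measurePreserving.quasiMeasurePreserving.ae hp)
  by_contra h_not
  exact ha (measure_mono_null (Set.singleton_subset_iff.2 h_not) (ae_iff.1 h_ae))

lemma IsAffineStationary.measure_lt_abs_ne_zero (h : IsAffineStationary ν r t μ)
    [NullSingletonClass μ] {a : α} (ha : ν {a} ≠ 0) (hra : 1 < r a) (R : ℝ) :
    μ {x | R < |x|} ≠ 0 := by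
  have := h.isProbabilityMeasure
  obtain ⟨x₀, hx₀⟩ : ∃ x₀, r a * x₀ + t a = x₀ := by
    have : 1 - r a ≠ 0 := by linarith
    exact ⟨t a / (1 - r a), by field_simp; ring⟩
  intro hR
  have h_bdd : ∀ᵐ x ∂μ, |x - x₀| ≤ R + |x₀| := by
    rw [← compl_mem_ae_iff] at hR
    filter_upwards [hR] with x hx
    exact (abs_sub x x₀).trans (by gcongr; exact not_lt.1 hx)
  have h_shrink (n : ℕ) : ∀ᵐ x ∂μ, r a ^ n * |x - x₀| ≤ R + |x₀| := by
    induction n with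
    | zero => simpa using h_bdd
    | succ n ih =>
      filter_upwards [h.ae_affine ih ha] with x hx
      rwa [← hx₀, add_sub_add_right_eq_sub, ← mul_sub, abs_mul, abs_of_pos (by linarith),
        ← mul_assoc, ← pow_succ, hx₀] at hx
  have h_eq : ∀ᵐ x ∂μ, x = x₀ := by
    filter_upwards [ae_all_iff.2 h_shrink] with x hx
    by_contra hne
    obtain ⟨n, hn⟩ := pow_unbounded_of_one_lt ((R + |x₀|) / |x - x₀|) hra
    exact (hx n).not_gt ((div_lt_iff₀ (abs_pos.2 (sub_ne_zero.2 hne))).1 hn)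
  have h_compl : μ {x₀}ᶜ = 0 := ae_iff.1 h_eq
  simp at h_compl

variable [IsProbabilityMeasure ν]

lemma IsAffineStationary.measure_singleton_div_eq (h : IsAffineStationary ν r t μ)
    (hr : ∀ a, r a ≠ 0) {x : ℝ} (hx : ∀ y, μ {y} ≤ μ {x}) {a : α} (ha : ν {a} ≠ 0) :
    μ {(x - t a) / r a} = μ {x} := by
  have := h.isProbabilityMeasure
  have h_avg : μ {x} = ∫⁻ a, μ {(x - t a) / r a} ∂ν := by
    rw [← h.measurePreserving.measure_preimage (measurableSet_singleton x).nullMeasurableSet,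
      Measure.prod_apply (h.measurePreserving.measurable (measurableSet_singleton x))]
    refine lintegral_congr fun a => congrArg μ ?_
    ext y
    simp [eq_div_iff (hr a), eq_sub_iff_add_eq, mul_comm]
  have h_eq := ae_eq_of_ae_le_of_lintegral_le (μ := ν) (f := fun a => μ {(x - t a) / r a})
    (g := fun _ => μ {x}) (.of_forall fun a => hx _) (h_avg ▸ measure_ne_top μ {x})
    aemeasurable_const (by simp [← h_avg])
  by_contra h_ne
  exact ha (measure_mono_null (Set.singleton_subset_iff.2 h_ne) (ae_iff.1 h_eq))

lemma IsAffineStationary.nullSingletonClass (h : IsAffineStationary ν r t μ) (hr : ∀ a, r a ≠ 0)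
    (hν : ∀ a, ν {a} ≠ 0) (h_fix : ¬ ∃ x, ∀ a, r a * x + t a = x) : NullSingletonClass μ := by
  have := h.isProbabilityMeasure
  by_contra h_atoms
  obtain ⟨x₀, hx₀, h_max⟩ := exists_forall_measure_singleton_le h_atoms
  have h_fin : {x | μ {x} = μ {x₀}}.Finite :=
    (finite_setOf_le_measure_singleton μ hx₀).subset fun x hx => hx.ge
  refine h_fix ⟨_, fun a => mul_centroid_add_eq (F := h_fin.toFinset) ⟨x₀, by simp⟩ (hr a)
    fun x hx => ?_⟩
  rw [Set.Finite.mem_toFinset, Set.mem_ofPred_eq] at hx ⊢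
  exact (h.measure_singleton_div_eq hr (hx.symm ▸ h_max) (hν a)).trans hx

end Atoms

section TwoMaps

/-- The law of a fair coin toss. -/
noncomputable def coin : Measure Bool :=
  (2⁻¹ : ℝ≥0∞) • Measure.dirac true + (2⁻¹ : ℝ≥0∞) • Measure.dirac false

instance : IsProbabilityMeasure coin := ⟨by simp [coin, ENNReal.inv_two_add_inv_two]⟩

/-- The function on the two-letter alphabet with values `x` at `true` and `y` at `false`, so that
`f₁` and `f₂` are the maps `z ↦ byLetter l₁ l₂ a * z + byLetter d₁ d₂ a` for the two letters. -/
def byLetter {R : Type*} (x y : R) (a : Bool) : R := cond a x y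

lemma integral_coin (f : Bool → ℝ) : ∫ a, f a ∂coin = (f true + f false) / 2 := by
  have h (a : Bool) : Integrable f ((2⁻¹ : ℝ≥0∞) • Measure.dirac a) :=
    .smul_measure .of_finite (by simp)
  rw [coin, integral_add_measure (h _) (h _)]
  simp; ring

lemma coin_singleton_ne_zero (a : Bool) : coin {a} ≠ 0 := by cases a <;> simp [coin]

variable {l₁ l₂ d₁ d₂ : ℝ} {μ : Measure ℝ}

lemma byLetter_pos (hl₁ : 0 < l₁) (hl₂ : 0 < l₂) (a : Bool) : 0 < byLetter l₁ l₂ a := by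
  cases a <;> assumption

lemma integral_log_byLetter_lt (hl₁ : 0 < l₁) (hl₂ : 0 < l₂) {c : ℝ} (hl : l₁ * l₂ < c ^ 2) :
    ∫ a, Real.log (byLetter l₁ l₂ a) ∂coin < Real.log c := by
  have h_log := Real.log_lt_log (mul_pos hl₁ hl₂) hl
  rw [Real.log_mul hl₁.ne' hl₂.ne', Real.log_pow, Nat.cast_two] at h_log
  rw [integral_coin]
  change (Real.log l₁ + Real.log l₂) / 2 < Real.log c
  linarith

lemma integral_log_byLetter_neg (hl₁ : 0 < l₁) (hl₂ : 0 < l₂) (hl : l₁ * l₂ < 1) :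
    ∫ a, Real.log (byLetter l₁ l₂ a) ∂coin < 0 :=
  Real.log_one ▸ integral_log_byLetter_lt hl₁ hl₂ (by rwa [one_pow])

lemma isStationaryMeasure_iff_isAffineStationary :
    IsStationaryMeasure l₁ l₂ d₁ d₂ μ ↔
      IsAffineStationary coin (byLetter l₁ l₂) (byLetter d₁ d₂) μ := by
  have h_meas : Measurable fun q : Bool × ℝ => byLetter l₁ l₂ q.1 * q.2 + byLetter d₁ d₂ q.1 := by
    have := measurable_of_finite (byLetter l₁ l₂)
    have := measurable_of_finite (byLetter d₁ d₂)
    fun_prop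
  have h_map (a : Bool) [SFinite μ] : ((Measure.dirac a).prod μ).map
      (fun q => byLetter l₁ l₂ q.1 * q.2 + byLetter d₁ d₂ q.1)
        = μ.map fun y => byLetter l₁ l₂ a * y + byLetter d₁ d₂ a := by
    rw [Measure.dirac_prod, Measure.map_map h_meas (by fun_prop)]; rfl
  have h_eq [SFinite μ] : (coin.prod μ).map
      (fun q => byLetter l₁ l₂ q.1 * q.2 + byLetter d₁ d₂ q.1)
        = (2⁻¹ : ℝ≥0∞) • μ.map (fun y => l₁ * y + d₁)
          + (2⁻¹ : ℝ≥0∞) • μ.map (fun y => l₂ * y + d₂) := by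
    rw [coin, Measure.add_prod, Measure.prod_smul_left, Measure.prod_smul_left,
      Measure.map_add _ _ h_meas, Measure.map_smul, Measure.map_smul, h_map, h_map]; rfl
  constructor
  · rintro ⟨h_prob, h⟩
    exact ⟨h_prob, h_meas, h_eq.trans h.symm⟩
  · rintro ⟨h_prob, -, h⟩
    exact ⟨h_prob, (h_eq.symm.trans h).symm⟩

lemma stationaryMeasure_eq_map_limitPoint (hl₁ : 0 < l₁) (hl₂ : 0 < l₂) (hl : l₁ * l₂ < 1) :
    stationaryMeasure l₁ l₂ d₁ d₂ =
      (seqLaw coin).map (limitPoint (byLetter l₁ l₂) (byLetter d₁ d₂)) := by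
  have h_log := integral_log_byLetter_neg hl₁ hl₂ hl
  have h_pos := byLetter_pos hl₁ hl₂
  have h_unique : ∃! μ, IsStationaryMeasure l₁ l₂ d₁ d₂ μ := by
    simp only [isStationaryMeasure_iff_isAffineStationary]
    exact ⟨_, isAffineStationary_map_limitPoint h_pos h_log,
      fun μ hμ => hμ.eq_map_limitPoint h_pos h_log⟩
  rw [stationaryMeasure, dif_pos h_unique]
  exact (isStationaryMeasure_iff_isAffineStationary.1 h_unique.choose_spec.1).eq_map_limitPoint
    h_pos h_log

instance : IsFiniteMeasure (stationaryMeasure l₁ l₂ d₁ d₂) := by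
  unfold stationaryMeasure
  split_ifs with h
  · have := h.choose_spec.1.1; infer_instance
  · infer_instance

lemma isAffineStationary_stationaryMeasure (hl₁ : 0 < l₁) (hl₂ : 0 < l₂) (hl : l₁ * l₂ < 1) :
    IsAffineStationary coin (byLetter l₁ l₂) (byLetter d₁ d₂) (stationaryMeasure l₁ l₂ d₁ d₂) :=
  stationaryMeasure_eq_map_limitPoint (d₁ := d₁) (d₂ := d₂) hl₁ hl₂ hl ▸
    isAffineStationary_map_limitPoint (byLetter_pos hl₁ hl₂) (integral_log_byLetter_neg hl₁ hl₂ hl)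

end TwoMaps

section AnalyticPreimage

lemma exists_mem_nhds_addHaar_inter_preimage_eq_zero {E : Type*} [NormedAddCommGroup E]
    [NormedSpace ℝ E] [FiniteDimensional ℝ E] [MeasurableSpace E] [BorelSpace E] {μ : Measure E}
    [μ.IsAddHaarMeasure] {f : E → E} {f' : E ≃L[ℝ] E} {x : E} (hf : ContDiffAt ℝ 1 f x)
    (hf' : HasFDerivAt f (f' : E →L[ℝ] E) x) {s : Set E} (hs : μ s = 0) :
    ∃ u ∈ 𝓝 x, μ (u ∩ f ⁻¹' s) = 0 := by
  have h_strict : HasStrictFDerivAt f (f' : E →L[ℝ] E) x :=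
    hf.hasStrictFDerivAt' hf' one_ne_zero
  set g := h_strict.localInverse f f' x
  have hg : ∀ᶠ y in 𝓝 (f x), DifferentiableAt ℝ g y := by
    filter_upwards [(hf.to_localInverse hf' one_ne_zero).eventually (by simp)] with y hy
    exact hy.differentiableAt one_ne_zero
  refine ⟨_, (hf.continuousAt.eventually hg).and h_strict.eventually_left_inverse,
    measure_mono_null ?_ (addHaar_image_eq_zero_of_differentiableOn_of_addHaar_eq_zero μ
      (f := g) (s := {y | DifferentiableAt ℝ g y} ∩ s)
      (fun y hy => hy.1.differentiableWithinAt) (measure_mono_null Set.inter_subset_right hs))⟩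
  rintro y ⟨⟨hy, h_inv⟩, hys⟩
  exact ⟨f y, ⟨hy, hys⟩, h_inv⟩

lemma ae_notMem_of_analyticOnNhd {g : ℝ → ℝ} {U s : Set ℝ} (hU : IsOpen U)
    (hU' : IsPreconnected U) (hg : AnalyticOnNhd ℝ g U) (h_ne : ∃ x ∈ U, ∃ y ∈ U, g x ≠ g y)
    (hs : volume s = 0) : ∀ᵐ x ∂volume.restrict U, g x ∉ s := by
  have h_deriv : ∀ᵐ x ∂volume.restrict U, deriv g x ≠ 0 := by
    refine ae_restrict_le_codiscreteWithin hU.measurableSet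
      ((hg.deriv.eqOn_zero_or_eventually_ne_zero_of_preconnected hU').resolve_left fun h => ?_)
    obtain ⟨c, hc⟩ := hU.exists_is_const_of_deriv_eq_zero hU'
      (fun y hy => (hg y hy).differentiableAt.differentiableWithinAt) h
    obtain ⟨x, hx, y, hy, hxy⟩ := h_ne
    exact hxy ((hc x hx).trans (hc y hy).symm)
  have h_regular : volume (U ∩ {x | deriv g x ≠ 0} ∩ g ⁻¹' s) = 0 := by
    refine measure_null_of_locally_null _ fun x ⟨⟨hxU, hx⟩, _⟩ => ?_
    obtain ⟨u, hu, hu_null⟩ := exists_mem_nhds_addHaar_inter_preimage_eq_zero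
      (hg x hxU).contDiffAt ((hg x hxU).differentiableAt.hasDerivAt.hasFDerivAt_equiv hx) hs
    exact ⟨_, inter_mem self_mem_nhdsWithin (mem_nhdsWithin_of_mem_nhds hu),
      measure_mono_null (Set.subset_inter Set.inter_subset_right
        (Set.inter_subset_left.trans Set.inter_subset_right)) hu_null⟩
  have h_ae := measure_eq_zero_iff_ae_notMem.1 h_regular
  filter_upwards [h_deriv, ae_restrict_mem hU.measurableSet, ae_restrict_of_ae h_ae]
    with x hx hxU hx_reg hxs
  exact hx_reg ⟨⟨hxU, hx⟩, hxs⟩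

lemma ae_map_mutuallySingular {Ω : Type*} [MeasurableSpace Ω] {P : Measure Ω} [SFinite P]
    {X : ℝ → Ω → ℝ} (hX : Measurable X.uncurry) {U : Set ℝ} (hU : IsOpen U)
    (hU' : IsPreconnected U) (h_an : ∀ᵐ w ∂P, AnalyticOnNhd ℝ (fun l => X l w) U)
    (h_ne : ∀ᵐ w ∂P, ∃ x ∈ U, ∃ y ∈ U, X x w ≠ X y w) {ν : Measure ℝ} (hν : ν ⟂ₘ volume) :
    ∀ᵐ l ∂volume.restrict U, P.map (X l) ⟂ₘ ν := by
  obtain ⟨s, hs, hνs, hs_null⟩ := hν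
  have h_ae : ∀ᵐ w ∂P, ∀ᵐ l ∂volume.restrict U, X l w ∉ sᶜ := by
    filter_upwards [h_an, h_ne] with w hw_an hw_ne
    exact ae_notMem_of_analyticOnNhd hU hU' hw_an hw_ne hs_null
  have h_meas : MeasurableSet {q : Ω × ℝ | X q.2 q.1 ∉ sᶜ} :=
    (hX.comp measurable_swap) hs.compl.compl
  rw [Measure.ae_ae_comm h_meas] at h_ae
  filter_upwards [h_ae] with l hl
  refine .symm ⟨s, hs, hνs, ?_⟩
  rw [Measure.map_apply hX.of_uncurry_left hs.compl]
  exact measure_eq_zero_iff_ae_notMem.2 hl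

end AnalyticPreimage

section Parameter

lemma differentiableOn_limitPoint {α : Type*} [Finite α] {R : ℂ → α → ℂ} {ρ : α → ℝ}
    {w : ℕ → α} {U : Set ℂ} (hU : IsOpen U) (hR : ∀ a, DifferentiableOn ℂ (fun z => R z a) U)
    (hρ : ∀ z ∈ U, ∀ a, ‖R z a‖ ≤ ρ a) (hw : Summable (weight ρ w)) (t : α → ℂ) :
    DifferentiableOn ℂ (fun z => limitPoint (R z) t w) U := by
  obtain ⟨T, hT⟩ := exists_norm_le_of_finite t
  refine Complex.differentiableOn_tsum_of_summable_norm (hw.mul_right T)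
    (fun i => (DifferentiableOn.fun_finsetProd fun j _ => hR _).mul_const _) hU fun i z hz => ?_
  have h_weight := norm_weight_le (hρ z hz) w i
  rw [norm_mul]
  exact mul_le_mul h_weight (hT _) (norm_nonneg _) ((norm_nonneg _).trans h_weight)

lemma ofReal_limitPoint {α : Type*} (r t : α → ℝ) (w : ℕ → α) :
    ((limitPoint r t w : ℝ) : ℂ) = limitPoint (fun a => (r a : ℂ)) (fun a => (t a : ℂ)) w := by
  simp [limitPoint, weight, Complex.ofReal_tsum]

variable {b l L : ℝ} {w : ℕ → Bool}

lemma analyticOnNhd_limitPoint (hb : 0 ≤ b) (hw : Summable (weight (byLetter L b) w))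
    (t : Bool → ℝ) :
    AnalyticOnNhd ℝ (fun l => limitPoint (byLetter l b) t w) (Set.Ioo (-L) L) := by
  intro l hl
  have h_diff : DifferentiableOn ℂ
      (fun z => limitPoint (byLetter z (b : ℂ)) (fun a => (t a : ℂ)) w) (Metric.ball 0 L) := by
    refine differentiableOn_limitPoint Metric.isOpen_ball (fun a => ?_) (fun z hz a => ?_) hw _
    · cases a
      · exact differentiableOn_const _
      · exact differentiableOn_id
    · cases a
      · simp [byLetter, abs_of_nonneg hb]
      · exact (mem_ball_zero_iff.1 hz).le
  have h_an := (h_diff.analyticAt (z := (l : ℂ))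
    (Metric.isOpen_ball.mem_nhds (by simpa [abs_lt] using hl))).re_ofReal
  refine h_an.congr (.of_forall fun x => ?_)
  have h_coe : byLetter (x : ℂ) b = fun a => ((byLetter x b a : ℝ) : ℂ) := by
    ext a; cases a <;> rfl
  simp only [h_coe, ← ofReal_limitPoint, Complex.ofReal_re]

lemma limitPoint_ne_limitPoint_zero {t : Bool → ℝ} (hl : 0 < l) (hb : 0 < b)
    (hw : Summable (weight (byLetter l b) w))
    (h₀ : ∀ n, limitPoint (byLetter l b) t (tail^[n] w) ≠ 0) (h_mem : ∃ n, w n = true) :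
    limitPoint (byLetter l b) t w ≠ limitPoint (byLetter 0 b) t w := by
  obtain ⟨n, hn⟩ := h_mem
  have h_le (a : Bool) : ‖byLetter 0 b a‖ ≤ byLetter l b a := by
    cases a <;> simp [byLetter, abs_of_pos hb, hl.le]
  have h_summable {w : ℕ → Bool} (hw : Summable (weight (byLetter l b) w)) :
      Summable fun n => ‖weight (byLetter 0 b) w n‖ :=
    .of_nonneg_of_le (fun _ => norm_nonneg _) (norm_weight_le h_le w) hw
  induction n generalizing w with
  | zero =>
    rw [limitPoint_eq hw.norm, limitPoint_eq (h_summable hw)]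
    simpa [hn, byLetter, hl.ne'] using h₀ 1
  | succ n ih =>
    rw [limitPoint_eq hw.norm, limitPoint_eq (h_summable hw)]
    cases h : w 0
    · simpa [byLetter, hb.ne'] using ih (summable_weight_tail (byLetter_pos hl hb _).ne' hw)
        (fun k => h₀ (k + 1)) hn
    · simpa [byLetter, hl.ne'] using h₀ 1

lemma ae_forall_limitPoint_tail_ne_zero {α : Type*} [MeasurableSpace α] [Finite α]
    [MeasurableSingletonClass α] (ν : Measure α) [IsProbabilityMeasure ν] (r t : α → ℝ)
    [NullSingletonClass ((seqLaw ν).map (limitPoint r t))] :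
    ∀ᵐ w ∂seqLaw ν, ∀ n, limitPoint r t (tail^[n] w) ≠ 0 := by
  refine ae_all_iff.2 fun n => ?_
  refine ((measurePreserving_tail ν).iterate n).quasiMeasurePreserving.ae
    (p := fun w => limitPoint r t w ≠ 0) ?_
  exact ae_of_ae_map (measurable_limitPoint r t).aemeasurable
    (p := fun x => x ≠ 0) (measure_eq_zero_iff_ae_notMem.1 (measure_singleton 0))

lemma ae_stationaryMeasure_mutuallySingular {d₁ d₂ : ℝ} (hl : 0 < l) (hlL : l < L) (hb : 0 < b)
    (hL : L * b < 1) [NullSingletonClass (stationaryMeasure l b d₁ d₂)] {ν : Measure ℝ}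
    (hν : ν ⟂ₘ volume) :
    ∀ᵐ x ∂volume.restrict (Set.Ioo 0 L), stationaryMeasure x b d₁ d₂ ⟂ₘ ν := by
  have h_summable {x : ℝ} (hx : 0 < x) (hxL : x ≤ L) :
      ∀ᵐ w ∂seqLaw coin, Summable (weight (byLetter x b) w) :=
    ae_summable_weight coin (byLetter_pos hx hb) <| integral_log_byLetter_neg hx hb <|
      (mul_le_mul_of_nonneg_right hxL hb.le).trans_lt hL
  have h_law {x : ℝ} (hx : 0 < x) (hxL : x ≤ L) := stationaryMeasure_eq_map_limitPoint
    (d₁ := d₁) (d₂ := d₂) hx hb ((mul_le_mul_of_nonneg_right hxL hb.le).trans_lt hL)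
  have : NullSingletonClass ((seqLaw coin).map (limitPoint (byLetter l b) (byLetter d₁ d₂))) :=
    h_law hl hlL.le ▸ inferInstance
  have h_meas : Measurable fun q : ℝ × (ℕ → Bool) =>
      limitPoint (byLetter q.1 b) (byLetter d₁ d₂) q.2 :=
    measurable_uncurry_limitPoint (R := fun x => byLetter x b)
      (Bool.forall_bool.2 ⟨measurable_const, measurable_id⟩) _
  -- `(-L, L)` contains the parameter `0`, at which the series terminates at the first `true`;
  -- comparing the values at `0` and `l` shows that it is not constant in the parameter.
  have h_ae := ae_map_mutuallySingular (P := seqLaw coin)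
    (X := fun x => limitPoint (byLetter x b) (byLetter d₁ d₂)) h_meas isOpen_Ioo
    isPreconnected_Ioo (U := Set.Ioo (-L) L) ?_ ?_ hν
  · filter_upwards [ae_restrict_of_ae_restrict_of_subset
      (Set.Ioo_subset_Ioo_left (by linarith)) h_ae, ae_restrict_mem measurableSet_Ioo] with x hx hxL
    rwa [h_law hxL.1 hxL.2.le]
  · filter_upwards [h_summable (hl.trans hlL) le_rfl] with w hw
    exact analyticOnNhd_limitPoint hb.le hw _
  · filter_upwards [h_summable hl hlL.le, ae_forall_limitPoint_tail_ne_zero coin (byLetter l b)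
      (byLetter d₁ d₂), ae_exists_mem (.singleton true) (coin_singleton_ne_zero true)]
      with w hw h₀ h_mem
    exact ⟨l, ⟨by linarith, hlL⟩, 0, ⟨by linarith, by linarith⟩,
      limitPoint_ne_limitPoint_zero hl hb hw h₀ h_mem⟩

end Parameter

section Superposition

open scoped BoundedContinuousFunction
open Function (support)

variable {E : Type*} [NormedAddCommGroup E]

lemma exists_isOpen_pairwise_disjoint_locallyFinite [MeasurableSpace E] {μ : Measure E}
    (h : ∀ R : ℝ, μ {x | R < ‖x‖} ≠ 0) :
    ∃ V : ℕ → Set E, (∀ n, IsOpen (V n)) ∧ Pairwise (Function.onFun Disjoint V) ∧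
      LocallyFinite V ∧ ∀ n, μ (V n) ≠ 0 := by
  have h_step (R : ℝ) : ∃ R' ≥ R + 1, μ {x | R < ‖x‖ ∧ ‖x‖ < R'} ≠ 0 := by
    by_contra! h₀
    refine h R (measure_mono_null (fun x (hx : R < ‖x‖) => ?_)
      (measure_iUnion_null fun n : ℕ => h₀ (R + 1 + n) (by simp)))
    obtain ⟨n, hn⟩ := exists_nat_gt (‖x‖ - (R + 1))
    exact Set.mem_iUnion.2 ⟨n, hx, by linarith⟩
  choose g hg hgμ using h_step
  set r : ℕ → ℝ := fun n => g^[n] 0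
  have hr (n : ℕ) : r (n + 1) = g (r n) := Function.iterate_succ_apply' g n 0
  have hr_mono : Monotone r := monotone_nat_of_le_succ fun n => by linarith [hr n, hg (r n)]
  have hr_ge (n : ℕ) : (n : ℝ) ≤ r n := by
    induction n with
    | zero => simp [r]
    | succ n ih => push_cast; linarith [hr n, hg (r n)]
  refine ⟨fun n => {x | r n < ‖x‖ ∧ ‖x‖ < r (n + 1)}, fun n => ?_, ?_, fun x => ?_, fun n => ?_⟩
  · exact (isOpen_lt continuous_const continuous_norm).inter
      (isOpen_lt continuous_norm continuous_const)
  · refine (pairwise_disjoint_on _).2 fun m n hmn => Set.disjoint_left.2 fun x hm hn => ?_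
    exact (hm.2.trans_le (hr_mono hmn)).not_gt hn.1
  · obtain ⟨N, hN⟩ := exists_nat_gt ‖x‖
    refine ⟨{y | ‖y‖ < N}, (isOpen_lt continuous_norm continuous_const).mem_nhds hN,
      (Set.finite_Iio N).subset ?_⟩
    rintro n ⟨y, hy, hyN⟩
    exact_mod_cast (hr_ge n).trans_lt (hy.1.trans hyN)
  · simpa only [hr n] using hgμ (r n)

variable [NormedSpace ℝ E]

lemma exists_superposition {f : ℕ → E →ᵇ ℝ} (hf : ∀ n, ContDiff ℝ ∞ (f n))
    (h_norm : ∀ n, ‖f n‖ ≤ 1) (h_disj : Pairwise (Function.onFun Disjoint fun n => support (f n)))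
    (h_fin : LocallyFinite fun n => support (f n)) :
    ∃ S : lp (fun _ : ℕ => ℝ) ⊤ →L[ℝ] (E →ᵇ ℝ),
      (∀ a, ContDiff ℝ ∞ (S a)) ∧ ∀ n, S (lp.single ⊤ n 1) = f n := by
  have h_index (x : E) : ∃ m, ∀ n, n ≠ m → f n x = 0 := by
    by_contra! h
    obtain ⟨m, -, hm⟩ := h 0
    obtain ⟨n, hnm, hn⟩ := h m
    exact Set.disjoint_left.1 (h_disj hnm) hn hm
  choose m hm using h_index
  have h_bound (a : lp (fun _ : ℕ => ℝ) ⊤) (x : E) : ‖a (m x) * f (m x) x‖ ≤ ‖a‖ := by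
    have hf_le : ‖f (m x) x‖ ≤ 1 := ((f (m x)).norm_coe_le_norm x).trans (h_norm _)
    rw [norm_mul]
    exact (mul_le_of_le_one_right (norm_nonneg _) hf_le).trans
      (lp.norm_apply_le_norm ENNReal.top_ne_zero a _)
  have h_smooth (a : lp (fun _ : ℕ => ℝ) ⊤) : ContDiff ℝ ∞ fun x => a (m x) * f (m x) x := by
    have h_sum : (fun x => a (m x) * f (m x) x) = fun x => ∑ᶠ n, a n * f n x := funext fun x =>
      (finsum_eq_single (fun n => a n * f n x) (m x) fun n hn => by rw [hm x n hn, mul_zero]).symm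
    rw [h_sum, ← contMDiff_iff_contDiff]
    exact contMDiff_finsum (fun n => (contDiff_const.mul (hf n)).contMDiff)
      (h_fin.subset fun n => Function.support_mul_subset_right _ _)
  let S : lp (fun _ : ℕ => ℝ) ⊤ →ₗ[ℝ] (E →ᵇ ℝ) :=
    { toFun a := .ofNormedAddCommGroup _ (h_smooth a).continuous ‖a‖ (h_bound a)
      map_add' a b := by ext x; simp [add_mul]
      map_smul' c a := by ext x; simp [mul_assoc] }
  refine ⟨S.mkContinuous 1 fun a => ?_, h_smooth, fun n => ?_⟩
  · rw [one_mul]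
    exact BoundedContinuousFunction.norm_ofNormedAddCommGroup_le _ (norm_nonneg a) (h_bound a)
  · ext x
    change lp.single (E := fun _ : ℕ => ℝ) ⊤ n (1 : ℝ) (m x) * f (m x) x = f n x
    rcases eq_or_ne n (m x) with rfl | hn
    · simp
    · simp [hm x n hn, hn.symm]

lemma exists_forall_norm_apply_le {f : ℕ → E →ᵇ ℝ} (hf : ∀ n, ContDiff ℝ ∞ (f n))
    (h_norm : ∀ n, ‖f n‖ ≤ 1) (h_disj : Pairwise (Function.onFun Disjoint fun n => support (f n)))
    (h_fin : LocallyFinite fun n => support (f n)) {Λ : ℕ → (E →ᵇ ℝ) →L[ℝ] ℝ}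
    (hΛ : ∀ φ : E →ᵇ ℝ, ContDiff ℝ ∞ φ → ∃ C, ∀ n, ‖Λ n φ‖ ≤ C) :
    ∃ C, ∀ n, ‖Λ n (f n)‖ ≤ C := by
  obtain ⟨S, hS, hSf⟩ := exists_superposition hf h_norm h_disj h_fin
  obtain ⟨C, hC⟩ := banach_steinhaus (g := fun n => Λ n ∘L S) fun a => hΛ (S a) (hS a)
  refine ⟨C, fun n => ?_⟩
  have h_single : ‖lp.single (E := fun _ : ℕ => ℝ) ⊤ n (1 : ℝ)‖ ≤ 1 := by
    rw [lp.norm_single ENNReal.zero_lt_top, norm_one]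
  simpa [hSf] using (Λ n ∘L S).le_of_opNorm_le_of_le (hC n) h_single

end Superposition

section Separation

open scoped BoundedContinuousFunction Manifold
open Function (support)

lemma exists_isCompact_subset_isOpen_lt_sub {X : Type*} [TopologicalSpace X] [MeasurableSpace X]
    [OpensMeasurableSpace X] {μ ν : Measure X} [μ.OuterRegular] [ν.InnerRegularCompactLTTop]
    [IsFiniteMeasure ν] (h : μ ⟂ₘ ν) {V : Set X} (hV : IsOpen V) {c : ℝ} (hc₀ : 0 ≤ c)
    (hc : c < ν.real V) :
    ∃ K U, IsCompact K ∧ IsOpen U ∧ K ⊆ U ∧ U ⊆ V ∧ c < ν.real K - μ.real U := by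
  obtain ⟨A, hA, hμA, hνA⟩ := h
  have hcV : ENNReal.ofReal c < ν (V ∩ A) := by
    rw [measure_inter_conull hνA]
    exact (ENNReal.ofReal_lt_iff_lt_toReal hc₀ (measure_ne_top ν V)).2 hc
  obtain ⟨K, hKVA, hK, hcK⟩ :=
    (hV.measurableSet.inter hA).exists_lt_isCompact_of_ne_top (measure_ne_top ν _) hcV
  have hμK : μ K < ENNReal.ofReal (ν.real K - c) := by
    rw [measure_mono_null (hKVA.trans Set.inter_subset_right) hμA, ENNReal.ofReal_pos, sub_pos]
    exact (ENNReal.ofReal_lt_iff_lt_toReal hc₀ (measure_ne_top ν K)).1 hcK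
  obtain ⟨U, hKU, hU, hμU⟩ := K.exists_isOpen_lt_of_lt _ hμK
  refine ⟨K, U ∩ V, hK, hU.inter hV, Set.subset_inter hKU (hKVA.trans Set.inter_subset_left),
    Set.inter_subset_right, lt_sub_comm.1 (ENNReal.toReal_lt_of_lt_ofReal ?_)⟩
  exact (measure_mono Set.inter_subset_left).trans_lt hμU

variable {E : Type*} [NormedAddCommGroup E] [NormedSpace ℝ E] [FiniteDimensional ℝ E]
  [MeasurableSpace E] [BorelSpace E]

lemma exists_contDiff_lt_integral_sub {μ ν : Measure E} [IsFiniteMeasure μ] [IsFiniteMeasure ν]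
    (h : μ ⟂ₘ ν) {V : Set E} (hV : IsOpen V) {c : ℝ} (hc₀ : 0 ≤ c) (hc : c < ν.real V) :
    ∃ f : E →ᵇ ℝ, ContDiff ℝ ∞ f ∧ support f ⊆ V ∧ ‖f‖ ≤ 1 ∧
      c < ∫ x, f x ∂ν - ∫ x, f x ∂μ := by
  obtain ⟨K, U, hK, hU, hKU, hUV, hcKU⟩ := exists_isCompact_subset_isOpen_lt_sub h hV hc₀ hc
  obtain ⟨f, hf, hf_range, hf_supp, hf_one⟩ := exists_contMDiff_support_eq_eq_one_iff
    (n := (⊤ : ℕ∞)) 𝓘(ℝ, E) hU hK.isClosed hKU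
  have hf_mem (x : E) : f x ∈ Set.Icc 0 1 := hf_range (Set.mem_range_self x)
  have hf_norm (x : E) : ‖f x‖ ≤ 1 := by
    rw [Real.norm_of_nonneg (hf_mem x).1]; exact (hf_mem x).2
  let φ : E →ᵇ ℝ := .ofNormedAddCommGroup f hf.continuous 1 hf_norm
  have hKφ : ν.real K ≤ ∫ x, φ x ∂ν := by
    rw [← integral_indicator_one hK.measurableSet]
    refine integral_mono ((integrable_const 1).indicator hK.measurableSet) (φ.integrable ν) ?_
    exact Set.indicator_le' (fun x hx => ((hf_one x).1 hx).ge) fun x _ => (hf_mem x).1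
  have hφU : ∫ x, φ x ∂μ ≤ μ.real U := by
    rw [← integral_indicator_one hU.measurableSet]
    refine integral_mono (φ.integrable μ) ((integrable_const 1).indicator hU.measurableSet) ?_
    refine Set.le_indicator (fun x _ => (hf_mem x).2) fun x hx => ?_
    exact (Function.notMem_support.1 (hf_supp ▸ hx)).le
  exact ⟨φ, hf.contDiff, hf_supp.subset.trans hUV, (φ.norm_le zero_le_one).2 hf_norm,
    by linarith⟩

end Separation

section NonDifferentiability

open scoped BoundedContinuousFunction
open Function (support)

variable {E : Type*} [NormedAddCommGroup E] [MeasurableSpace E] [BorelSpace E]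

/-- Integration against a finite measure as a continuous functional on bounded continuous
functions. -/
noncomputable def integralFunctional (μ : Measure E) [IsFiniteMeasure μ] : (E →ᵇ ℝ) →L[ℝ] ℝ :=
  LinearMap.mkContinuous
    { toFun f := ∫ x, f x ∂μ
      map_add' f g := integral_add (f.integrable μ) (g.integrable μ)
      map_smul' c f := integral_smul c f }
    (μ.real Set.univ) fun f => f.norm_integral_le_mul_norm μ

lemma exists_seq_tendsto_dist_lt {X : Type*} [PseudoMetricSpace X] {s : X} {p : X → Prop}
    (h : ∃ᶠ y in 𝓝[≠] s, p y) {δ : ℕ → ℝ} (hδ : ∀ n, 0 < δ n) :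
    ∃ y : ℕ → X, Tendsto y atTop (𝓝[≠] s) ∧ ∀ n, y n ≠ s ∧ p (y n) ∧ dist (y n) s < δ n := by
  have h_near (n : ℕ) : ∃ y, p y ∧ y ≠ s ∧ dist y s < min (δ n) (1 / (n + 1)) := by
    have h_ball := Metric.ball_mem_nhds s (lt_min (hδ n) (Nat.one_div_pos_of_nat (n := n)))
    exact (h.and_eventually ((eventually_mem_nhdsWithin (s := {s}ᶜ)).and
      (eventually_nhdsWithin_of_eventually_nhds h_ball))).exists
  choose y hpy hys hy_lt using h_near
  refine ⟨y, tendsto_nhdsWithin_iff.2 ⟨tendsto_iff_dist_tendsto_zero.2 ?_, .of_forall hys⟩,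
    fun n => ⟨hys n, hpy n, (hy_lt n).trans_le (min_le_left _ _)⟩⟩
  exact squeeze_zero (fun _ => dist_nonneg) (fun n => ((hy_lt n).trans_le (min_le_right _ _)).le)
    tendsto_one_div_add_atTop_nhds_zero_nat

lemma exists_forall_norm_slope_le {F : ℝ → ℝ} {s : ℝ} (hF : DifferentiableAt ℝ F s) {y : ℕ → ℝ}
    (hy : Tendsto y atTop (𝓝[≠] s)) : ∃ C, ∀ n, ‖slope F s (y n)‖ ≤ C := by
  have h_bdd := (hF.hasDerivAt.tendsto_slope.comp hy).norm.bddAbove_range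
  exact h_bdd.imp fun C hC n => hC (Set.mem_range_self n)

variable [NormedSpace ℝ E] [FiniteDimensional ℝ E]

theorem exists_contDiff_not_differentiableAt_integral {μ : ℝ → Measure E} {s : ℝ}
    [∀ y, IsFiniteMeasure (μ y)] (h_unbounded : ∀ R : ℝ, μ s {x | R < ‖x‖} ≠ 0)
    (h_sing : ∃ᶠ y in 𝓝[≠] s, μ y ⟂ₘ μ s) :
    ∃ φ : E →ᵇ ℝ, ContDiff ℝ ∞ φ ∧ ¬ DifferentiableAt ℝ (fun y => ∫ x, φ x ∂μ y) s := by
  obtain ⟨V, hV, hV_disj, hV_fin, hμV⟩ :=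
    exists_isOpen_pairwise_disjoint_locallyFinite h_unbounded
  set c : ℕ → ℝ := fun n => (μ s).real (V n) / 2
  have hV_pos (n : ℕ) : 0 < (μ s).real (V n) := ENNReal.toReal_pos (hμV n) (measure_ne_top _ _)
  have hc (n : ℕ) : 0 < c n := half_pos (hV_pos n)
  obtain ⟨y, hy, hy_props⟩ := exists_seq_tendsto_dist_lt h_sing
    fun n => div_pos (hc n) (n.cast_add_one_pos (α := ℝ))
  choose hys hy_sing hy_lt using hy_props
  choose f hf hfV hf_norm hcf using fun n =>
    exists_contDiff_lt_integral_sub (hy_sing n) (hV n) (hc n).le (half_lt_self (hV_pos n))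
  by_contra! h_diff
  set Λ : ℕ → (E →ᵇ ℝ) →L[ℝ] ℝ := fun n =>
    (y n - s)⁻¹ • (integralFunctional (μ (y n)) - integralFunctional (μ s))
  obtain ⟨C, hC⟩ := exists_forall_norm_apply_le hf hf_norm
    (fun m n hmn => (hV_disj hmn).mono (hfV m) (hfV n)) (hV_fin.subset hfV) (Λ := Λ)
    fun φ hφ => exists_forall_norm_slope_le (h_diff φ hφ) hy
  obtain ⟨n, hn⟩ := exists_nat_gt C
  refine (hC n).not_gt (hn.trans ?_)
  have h_dist : 0 < |y n - s| := abs_pos.2 (sub_ne_zero.2 (hys n))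
  calc (n : ℝ) < n + 1 := lt_add_one _
    _ < c n / |y n - s| := (lt_div_comm₀ (by positivity) h_dist).2 (hy_lt n)
    _ < |y n - s|⁻¹ * |∫ x, f n x ∂μ (y n) - ∫ x, f n x ∂μ s| := by
      rw [div_eq_inv_mul, abs_sub_comm (∫ x, f n x ∂μ (y n))]
      gcongr
      exact (hcf n).trans_le (le_abs_self _)
    _ = ‖Λ n (f n)‖ := by simp [Λ, integralFunctional]

end NonDifferentiability

lemma frequently_nhdsNE_of_ae_restrict {s : ℝ} {U : Set ℝ} (hU : U ∈ 𝓝 s) {p : ℝ → Prop}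
    (h : ∀ᵐ x ∂volume.restrict U, p x) : ∃ᶠ x in 𝓝[≠] s, p x := by
  have h_ae : ∀ᵐ x : ℝ, x ∈ U → p x := ae_imp_of_ae_restrict h
  have h_freq := mem_closure_iff_frequently.1 ((Measure.dense_of_ae h_ae).sdiff_singleton s s)
  refine frequently_nhdsWithin_iff.2 ((h_freq.and_eventually hU).mono ?_)
  exact fun x hx => ⟨hx.1.1 hx.2, hx.1.2⟩


theorem mainTheorem4 (l₁ l₂ d₁ d₂ : ℝ) (hl₁ : 0 < l₁) (hl₁' : l₁ < 1) (hl₂ : 1 < l₂)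
    (hl : l₁ * l₂ < 1 / 4)
    (hd : ¬ ∃ x : ℝ, l₁ * x + d₁ = x ∧ l₂ * x + d₂ = x) :
    ∃ φ : ℝ → ℝ, ContDiff ℝ ∞ φ ∧ (∃ C : ℝ, ∀ x : ℝ, |φ x| ≤ C) ∧
      ¬ DifferentiableAt ℝ
        (fun ε : ℝ => ∫ x, φ x ∂(stationaryMeasure (l₁ + ε) l₂ d₁ d₂)) 0 := by
  have hl₂₀ : 0 < l₂ := one_pos.trans hl₂
  have h := isAffineStationary_stationaryMeasure (d₁ := d₁) (d₂ := d₂) hl₁ hl₂₀ (by linarith)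
  have := h.isProbabilityMeasure
  have h_volume : stationaryMeasure l₁ l₂ d₁ d₂ ⟂ₘ volume :=
    h.mutuallySingular_volume (byLetter_pos hl₁ hl₂₀) <| by
      rw [Nat.card_eq_fintype_card, Fintype.card_bool, ← Real.log_inv]
      exact integral_log_byLetter_lt hl₁ hl₂₀ (by norm_num; linarith)
  have : NullSingletonClass (stationaryMeasure l₁ l₂ d₁ d₂) :=
    h.nullSingletonClass (fun a => (byLetter_pos hl₁ hl₂₀ a).ne') coin_singleton_ne_zero
      fun ⟨x, hx⟩ => hd ⟨x, hx true, hx false⟩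
  obtain ⟨L, hl₁L, hLl₂⟩ := exists_between ((lt_div_iff₀ hl₂₀).2 (by linarith : l₁ * l₂ < 1))
  rw [lt_div_iff₀ hl₂₀] at hLl₂
  have h_sing := frequently_nhdsNE_of_ae_restrict (Ioo_mem_nhds hl₁ hl₁L)
    (ae_stationaryMeasure_mutuallySingular (d₁ := d₁) (d₂ := d₂) hl₁ hl₁L hl₂₀ hLl₂ h_volume)
  obtain ⟨φ, hφ, h_diff⟩ := exists_contDiff_not_differentiableAt_integral
    (μ := fun x => stationaryMeasure x l₂ d₁ d₂)
    (h.measure_lt_abs_ne_zero (coin_singleton_ne_zero false) hl₂) h_sing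
  refine ⟨φ, hφ, ⟨‖φ‖, φ.norm_coe_le_norm⟩, fun h₀ => h_diff ?_⟩
  simpa only [add_zero] using (differentiableAt_comp_add_left
    (f := fun y => ∫ x, φ x ∂stationaryMeasure y l₂ d₁ d₂) l₁).1 h₀
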